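/- **Proposition 3.2.** Let $d\ge 1$, $0<\alpha\le 2$, and let $\gamma$ be a (nonnegative) measure on $\mathbb R^d$ of the form $\gamma=I_{d-\beta}\mu$, where $0<\beta\le d$ and $\mu$ is a finite (nonnegative) measure on $\mathbb R^d$ that is symmetric, i.e. invariant under $x\mapsto -x$. Here, for $0<\beta<d$, $I_{d-\beta}\mu$ is the measure with Lebesgue density $x\mapsto\int_{\mathbb R^d}|x-y|^{-\beta}\,d\mu(y)$, and $I_{d-\beta}\mu=\mu$ for $\beta=d$. Assume that one of the following holds: (i) $\beta<\alpha\wedge d$; (ii) $\beta=d=1$ and $\alpha>1$; (iii) $\beta=d\ge\alpha$ and $\mu=\gamma$ is absolutely continuous with a nonnegative density in $L^r(\mathbb R^d)$ for some $r\in(d/\alpha,\infty]$; if $r>2$, assume in addition the fractional Dalang condition $\int_{\mathbb R^d}\frac{|\widehat\gamma(\xi)|}{b+|\xi|^\alpha}\,d\xi<\infty$ for some $b>0$, where $\widehat\gamma(\xi)=\int_{\mathbb R^d}e^{-i\langle\xi,y\rangle}\,d\gamma(y)$. Then there are a number $2q\in\left(1,\frac{2d}{2d-\alpha}\wedge\frac{d+\alpha}{d}\right)$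 (with $\frac{2d}{2d-\alpha}=\infty$ if $2d=\alpha$) and a constant $C$ such that for all real-valued $f,g\in L^{2q}(\mathbb R^d)$ the convolution $(g*\gamma)(y)=\int_{\mathbb R^d}g(y-x)\,d\gamma(x)$ exists as an absolutely convergent integral for almost every $y$, the function $f\cdot(g*\gamma)$ is integrable, and $$\int_{\mathbb R^d}f(y)\,[g*\gamma](y)\,dy\le C\,\|f\|_{L^{2q}(\mathbb R^d)}\|g\|_{L^{2q}(\mathbb R^d)}.$$ -/

import Mathlib

open MeasureTheory

namespace FractionalHeat

/-- The Riesz potential `I_{d-β} μ` of a measure `μ` on `ℝ^d`, as a measure. For `β ≠ d` it is the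
measure with Lebesgue density `x ↦ ∫ |x - y|^{-β} dμ(y)` (with values in `[0, ∞]`, where
`|0|^{-β} = ∞` for `β > 0`); for `β = d` it is `μ` itself. -/
noncomputable def rieszPotential {d : ℕ} (β : ℝ) (μ : Measure (EuclideanSpace ℝ (Fin d))) :
    Measure (EuclideanSpace ℝ (Fin d)) :=
  open Classical in
  if β = (d : ℝ) then μ
  else volume.withDensity (fun x => ∫⁻ y, ‖x - y‖ₑ ^ (-β) ∂μ)

/-- The Fourier transform `ξ ↦ ∫ e^{-i⟨ξ, y⟩} dμ(y)` of a finite measure `μ` on `ℝ^d`. -/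
noncomputable def fourierMeasure {d : ℕ} (μ : Measure (EuclideanSpace ℝ (Fin d)))
    (ξ : EuclideanSpace ℝ (Fin d)) : ℂ :=
  ∫ y, Complex.exp (-(Complex.I * ((inner ℝ ξ y : ℝ) : ℂ))) ∂μ

/-- The fractional Dalang condition for a finite measure `μ`, whose Fourier transform is a
function: `∫ |μ̂(ξ)| / (b + |ξ|^α) dξ < ∞` for some `b > 0`. For a nonnegative definite `μ` one has
`μ̂ ≥ 0` and the absolute value can be left out. -/
def DalangCondition {d : ℕ} (α : ℝ) (μ : Measure (EuclideanSpace ℝ (Fin d))) : Prop :=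
  ∃ b : ℝ, 0 < b ∧ Integrable (fun ξ => ‖fourierMeasure μ ξ‖ / (b + ‖ξ‖ ^ α)) volume

/-- The standing assumption on the spatial covariance measure `γ` on `ℝ^d`:
`γ = I_{d-β} μ` with `0 < β ≤ d` and `μ` a finite symmetric measure, and one of three cases. -/
def CovarianceAssumption {d : ℕ} (α : ℝ) (γ : Measure (EuclideanSpace ℝ (Fin d))) : Prop :=
  ∃ (β : ℝ) (μ : Measure (EuclideanSpace ℝ (Fin d))),
    0 < β ∧ β ≤ d ∧ IsFiniteMeasure μ ∧ μ.map (fun x => -x) = μ ∧ γ = rieszPotential β μ ∧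
    (β < min α d ∨
     (β = d ∧ d = 1 ∧ 1 < α) ∨
     (β = d ∧ α ≤ d ∧
        ∃ (h : EuclideanSpace ℝ (Fin d) → ℝ) (r : ENNReal),
          (∀ x, 0 ≤ h x) ∧ γ = volume.withDensity (fun x => ENNReal.ofReal (h x)) ∧
          ENNReal.ofReal (d / α) < r ∧ MemLp h r volume ∧
          (2 < r → DalangCondition α γ)))

/-- The convolution `(g ∗ γ)(y) = ∫ g(y - x) dγ(x)` of a function with a measure. -/
noncomputable def convMeasure {d : ℕ} (g : EuclideanSpace ℝ (Fin d) → ℝ)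
    (γ : Measure (EuclideanSpace ℝ (Fin d))) (y : EuclideanSpace ℝ (Fin d)) : ℝ :=
  ∫ x, g (y - x) ∂γ

/-- The number `2d/(2d-α) ∧ (d+α)/d` in `[0, ∞]`. The first term is `∞` when `2d = α`, which for
`0 < α ≤ 2` and `d ≥ 1` happens for `d = 1`, `α = 2` only. -/
noncomputable def exponentBound (d : ℕ) (α : ℝ) : ENNReal :=
  min (ENNReal.ofReal (2 * d) / ENNReal.ofReal (2 * d - α)) (ENNReal.ofReal ((d + α) / d))

end FractionalHeat

/-! In every case the form `∫ f (g ∗ γ)` is bounded on `L^p` with `p = 2d/(2d-β)` for some `0 < β <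
α`, `β ≤ d`, and any such `p` lies in the required range. In case (i), averaging translates of
`|x|^{-β}` against the finite measure `μ` reduces to the diagonal Hardy–Littlewood–Sobolev
inequality (`hardyLittlewoodSobolev_normalized`). In case (ii), Cauchy–Schwarz and translation
invariance give `p = 2` for the finite measure `γ`. In case (iii), the density is in `L^1 ∩ L^r`,
hence in `L^s` for some finite `s > d/α`, and Young's inequality (`hasConvolutionBound_withDensity`)
applies with `β = d/s`.

Hardy–Littlewood–Sobolev is proved by splitting the double integral according to whether `g u ≤ f y`
or `f y ≤ g u`. On each half the smaller function is bounded by the value of the larger, and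
`lintegral_mul_enorm_rpow_le_of_le` turns that bound into exactly the missing power. Tonelli and
Fubini on `volume.prod γ` then carry the bounds over to real-valued functions. -/

namespace FractionalHeat

open ENNReal Module

/-! ### The diagonal Hardy–Littlewood–Sobolev inequality -/

section HardyLittlewoodSobolev

theorem enorm_smul_rpow {E : Type*} [NormedAddCommGroup E] [NormedSpace ℝ E] {R : ℝ} (hR : 0 < R)
    (s : ℝ) (x : E) :
    ‖R • x‖ₑ ^ s = ENNReal.ofReal (R ^ s) * ‖x‖ₑ ^ s := by
  have hRe : ‖R‖ₑ = ENNReal.ofReal R := by rw [Real.enorm_eq_ofReal hR.le]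
  rw [enorm_smul, hRe, ENNReal.mul_rpow_of_ne_top (by finiteness) (by finiteness),
    ENNReal.ofReal_rpow_of_pos hR]

variable {E : Type*} [NormedAddCommGroup E] [NormedSpace ℝ E] [FiniteDimensional ℝ E]
  [MeasurableSpace E] [BorelSpace E] (ν : Measure E) [ν.IsAddHaarMeasure]

theorem lintegral_eq_mul_lintegral_comp_smul {R : ℝ} (hR : 0 < R) (f : E → ℝ≥0∞) :
    ∫⁻ x, f x ∂ν = ENNReal.ofReal (R ^ finrank ℝ E) * ∫⁻ x, f (R • x) ∂ν := by
  have h1 : ∫⁻ x, f (R • x) ∂ν = ∫⁻ x, f x ∂(ν.map (R • ·)) :=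
    ((Homeomorph.smul (isUnit_iff_ne_zero.2 hR.ne').unit).toMeasurableEquiv.measurableEmbedding.lintegral_map f).symm
  have hp : 0 < R ^ finrank ℝ E := by positivity
  rw [h1, Measure.map_addHaar_smul ν hR.ne', lintegral_smul_measure, smul_eq_mul, ← mul_assoc,
    ← ENNReal.ofReal_mul hp.le, abs_of_pos (by positivity), mul_inv_cancel₀ hp.ne',
    ENNReal.ofReal_one, one_mul]

theorem setLIntegral_ball_enorm_rpow {R : ℝ} (hR : 0 < R) (s : ℝ) :
    ∫⁻ x in Metric.ball 0 R, ‖x‖ₑ ^ s ∂ν =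
      ENNReal.ofReal (R ^ (finrank ℝ E + s)) * ∫⁻ x in Metric.ball 0 1, ‖x‖ₑ ^ s ∂ν := by
  rw [← lintegral_indicator measurableSet_ball, ← lintegral_indicator measurableSet_ball,
    lintegral_eq_mul_lintegral_comp_smul ν hR, Real.rpow_add hR, Real.rpow_natCast,
    ENNReal.ofReal_mul (by positivity), mul_assoc,
    ← lintegral_const_mul' (ENNReal.ofReal (R ^ s)) _ (by finiteness)]
  congr 1
  refine lintegral_congr fun x => ?_
  have : R • x ∈ Metric.ball (0 : E) R ↔ x ∈ Metric.ball (0 : E) 1 := by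
    simp [norm_smul, abs_of_pos hR, hR]
  by_cases hx : x ∈ Metric.ball (0 : E) 1
  · rw [Set.indicator_of_mem (this.2 hx), Set.indicator_of_mem hx, enorm_smul_rpow hR]
  · rw [Set.indicator_of_notMem (fun h => hx (this.1 h)), Set.indicator_of_notMem hx, mul_zero]

theorem setLIntegral_compl_ball_enorm_rpow {R : ℝ} (hR : 0 < R) (s : ℝ) :
    ∫⁻ x in (Metric.ball 0 R)ᶜ, ‖x‖ₑ ^ s ∂ν =
      ENNReal.ofReal (R ^ (finrank ℝ E + s)) * ∫⁻ x in (Metric.ball 0 1)ᶜ, ‖x‖ₑ ^ s ∂ν := by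
  rw [← lintegral_indicator measurableSet_ball.compl,
    ← lintegral_indicator measurableSet_ball.compl,
    lintegral_eq_mul_lintegral_comp_smul ν hR, Real.rpow_add hR, Real.rpow_natCast,
    ENNReal.ofReal_mul (by positivity), mul_assoc,
    ← lintegral_const_mul' (ENNReal.ofReal (R ^ s)) _ (by finiteness)]
  congr 1
  refine lintegral_congr fun x => ?_
  have : R • x ∈ (Metric.ball (0 : E) R)ᶜ ↔ x ∈ (Metric.ball (0 : E) 1)ᶜ := by
    simp [norm_smul, abs_of_pos hR, hR]
  by_cases hx : x ∈ (Metric.ball (0 : E) 1)ᶜ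
  · rw [Set.indicator_of_mem (this.2 hx), Set.indicator_of_mem hx, enorm_smul_rpow hR]
  · rw [Set.indicator_of_notMem (fun h => hx (this.1 h)), Set.indicator_of_notMem hx, mul_zero]

theorem setLIntegral_ball_one_enorm_rpow_lt_top {β : ℝ} (hβ : 0 < β)
    (hβd : β < finrank ℝ E) :
    ∫⁻ x in Metric.ball 0 1, ‖x‖ₑ ^ (-β) ∂ν < ⊤ := by
  have hd : 1 ≤ finrank ℝ E := by
    have : (0 : ℝ) < finrank ℝ E := hβ.trans hβd
    exact_mod_cast this
  have : Nontrivial E := nontrivial_of_finrank_pos hd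
  have hi : IntegrableOn (fun x : E => ‖x‖ ^ (-β)) (Metric.ball 0 1) ν := by
    refine integrableOn_ball_of_norm_le_rpow (C := 1) (α := β) hd hβd ?_ ?_
    · refine Filter.Eventually.of_forall fun x => ?_
      rw [one_mul, Real.norm_of_nonneg (by positivity)]
    · exact (by fun_prop : Measurable fun x : E => ‖x‖ ^ (-β)).aestronglyMeasurable
  refine lt_of_le_of_lt (le_of_eq ?_) hi.2
  refine lintegral_congr_ae (ae_restrict_of_ae ?_)
  have : ∀ᵐ x ∂ν, x ≠ 0 := by simp [ae_iff]
  filter_upwards [this] with x hx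
  rw [Real.enorm_eq_ofReal (by positivity), ← ofReal_norm,
    ENNReal.ofReal_rpow_of_pos (by positivity)]

theorem setLIntegral_compl_ball_one_enorm_rpow_lt_top {s : ℝ} (hs : finrank ℝ E < s) :
    ∫⁻ x in (Metric.ball 0 1)ᶜ, ‖x‖ₑ ^ (-s) ∂ν < ⊤ := by
  have hs0 : 0 < s := lt_of_le_of_lt (Nat.cast_nonneg _) hs
  have h := finite_integral_one_add_norm (E := E) (μ := ν) hs
  have h2 : ENNReal.ofReal (2 ^ s) * ∫⁻ x : E, ENNReal.ofReal ((1 + ‖x‖) ^ (-s)) ∂ν < ⊤ :=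
    ENNReal.mul_lt_top (by finiteness) h
  refine lt_of_le_of_lt ?_ h2
  rw [← lintegral_const_mul' _ _ (by finiteness)]
  refine le_trans (setLIntegral_mono' measurableSet_ball.compl fun x hx => ?_)
    (setLIntegral_le_lintegral _ _)
  have hx1 : 1 ≤ ‖x‖ := by simpa using hx
  rw [← ofReal_norm, ENNReal.ofReal_rpow_of_pos (by positivity),
    ← ENNReal.ofReal_mul (by positivity)]
  apply ENNReal.ofReal_le_ofReal
  rw [Real.rpow_neg (by positivity), Real.rpow_neg (by positivity), ← div_eq_mul_inv,
    inv_eq_one_div, div_le_div_iff₀ (by positivity) (by positivity), one_mul,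
    ← Real.mul_rpow (by positivity) (by positivity)]
  exact Real.rpow_le_rpow (by positivity) (by linarith) hs0.le

/-- Split at radius `R`. The sup bound controls the ball by a multiple of `a R^{D-β}`; Hölder with
the `L^p` bound controls the complement by a multiple of `R^{-β/2}`. -/
theorem lintegral_mul_enorm_rpow_le_of_le {β : ℝ} (hβ : 0 < β) (hβd : β < finrank ℝ E)
    {h : E → ℝ≥0∞} (hm : Measurable h) {a : ℝ≥0∞} (ha0 : a ≠ 0) (hat : a ≠ ⊤)
    (ha : ∀ x, h x ≤ a)
    (hh : ∫⁻ x, h x ^ (2 * finrank ℝ E / (2 * finrank ℝ E - β) : ℝ) ∂ν ≤ 1) :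
    ∫⁻ x, h x * ‖x‖ₑ ^ (-β) ∂ν ≤
      (∫⁻ x in Metric.ball 0 1, ‖x‖ₑ ^ (-β) ∂ν +
        (∫⁻ x in (Metric.ball 0 1)ᶜ, ‖x‖ₑ ^ (-(2 * finrank ℝ E : ℝ)) ∂ν) ^
          (β / (2 * finrank ℝ E))) *
        a ^ (β / (2 * finrank ℝ E - β)) := by
  set D : ℝ := ((finrank ℝ E : ℕ) : ℝ) with hD
  have hD0 : 0 < D := hβ.trans hβd
  have hDβ : 0 < 2 * D - β := by linarith
  have ht : 0 < a.toReal := ENNReal.toReal_pos ha0 hat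
  set t := a.toReal with htdef
  have hta : a = ENNReal.ofReal t := (ENNReal.ofReal_toReal hat).symm
  -- This radius equates `t R^{D-β}` and `R^{-β/2}`; both become `t^{β/(2D-β)}`.
  set R : ℝ := t ^ (-(2 / (2 * D - β))) with hRdef
  have hR : 0 < R := by positivity
  have hpow : a ^ (β / (2 * D - β)) = ENNReal.ofReal (t ^ (β / (2 * D - β))) := by
    rw [hta, ENNReal.ofReal_rpow_of_pos ht]
  have near : ∫⁻ x in Metric.ball 0 R, h x * ‖x‖ₑ ^ (-β) ∂ν ≤
      (∫⁻ x in Metric.ball 0 1, ‖x‖ₑ ^ (-β) ∂ν) * a ^ (β / (2 * D - β)) := by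
    calc ∫⁻ x in Metric.ball 0 R, h x * ‖x‖ₑ ^ (-β) ∂ν
        ≤ ∫⁻ x in Metric.ball 0 R, a * ‖x‖ₑ ^ (-β) ∂ν :=
          lintegral_mono fun x => mul_le_mul_left (ha x) _
      _ = (∫⁻ x in Metric.ball 0 1, ‖x‖ₑ ^ (-β) ∂ν) * a ^ (β / (2 * D - β)) := by
          rw [lintegral_const_mul' _ _ hat, setLIntegral_ball_enorm_rpow ν hR, ← hD, ← mul_assoc,
            mul_comm, hpow, hta, ← ENNReal.ofReal_mul ht.le]
          congr 3
          rw [hRdef, ← Real.rpow_mul ht.le]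
          nth_rw 1 [← Real.rpow_one t]
          rw [← Real.rpow_add ht]
          congr 1
          field_simp
          ring
  have far : ∫⁻ x in (Metric.ball 0 R)ᶜ, h x * ‖x‖ₑ ^ (-β) ∂ν ≤
      (∫⁻ x in (Metric.ball 0 1)ᶜ, ‖x‖ₑ ^ (-(2 * D)) ∂ν) ^ (β / (2 * D)) *
        a ^ (β / (2 * D - β)) := by
    -- The conjugate exponent turns `‖x‖^{-β}` into `‖x‖^{-2D}`, which is integrable away from the
    -- origin.
    have hpq : (2 * D / (2 * D - β)).HolderConjugate (2 * D / β) := by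
      rw [Real.holderConjugate_iff]
      refine ⟨?_, ?_⟩
      · rw [lt_div_iff₀ hDβ]; linarith
      · field_simp; ring
    have key := ENNReal.lintegral_mul_le_Lp_mul_Lq (ν.restrict (Metric.ball 0 R)ᶜ) hpq
      (f := h) (g := fun x => ‖x‖ₑ ^ (-β)) hm.aemeasurable
      (by fun_prop : Measurable fun x : E => ‖x‖ₑ ^ (-β)).aemeasurable
    refine key.trans ?_
    have e1 : ∀ x : E, (‖x‖ₑ ^ (-β)) ^ (2 * D / β) = ‖x‖ₑ ^ (-(2 * D)) := fun x => by
      rw [← ENNReal.rpow_mul]; congr 1; field_simp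
    have h1 : (∫⁻ x in (Metric.ball 0 R)ᶜ, h x ^ (2 * D / (2 * D - β)) ∂ν) ^
        (1 / (2 * D / (2 * D - β))) ≤ 1 :=
      ENNReal.rpow_le_one ((setLIntegral_le_lintegral _ _).trans hh) (by positivity)
    refine (mul_le_mul_left h1 _).trans ?_
    simp_rw [e1]
    rw [one_mul, setLIntegral_compl_ball_enorm_rpow ν hR, ← hD, one_div_div,
      ENNReal.mul_rpow_of_nonneg _ _ (by positivity), mul_comm, hpow,
      ENNReal.ofReal_rpow_of_pos (by positivity), hRdef, ← Real.rpow_mul ht.le,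
      ← Real.rpow_mul ht.le]
    refine le_of_eq ?_
    congr 3
    field_simp
    ring
  rw [add_mul, ← lintegral_add_compl _ (measurableSet_ball (x := (0 : E)) (ε := R))]
  exact add_le_add near far

/-- For fixed `y`, truncate `g` at height `a = f y`: the inner integral gains `f y ^ (β/(2D-β))`,
and with the factor `f y` this is `f y ^ p`. -/
theorem lintegral_lintegral_le_one_side {β : ℝ} (hβ : 0 < β) (hβd : β < finrank ℝ E)
    {f g : E → ℝ≥0∞} (hg : Measurable g) (hft : ∀ x, f x ≠ ⊤)
    (hgp : ∫⁻ x, g x ^ (2 * finrank ℝ E / (2 * finrank ℝ E - β) : ℝ) ∂ν ≤ 1) :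
    ∫⁻ y, ∫⁻ u, {u | g u ≤ f y}.indicator (fun u => f y * g u * ‖y - u‖ₑ ^ (-β)) u ∂ν ∂ν ≤
      (∫⁻ x in Metric.ball 0 1, ‖x‖ₑ ^ (-β) ∂ν +
        (∫⁻ x in (Metric.ball 0 1)ᶜ, ‖x‖ₑ ^ (-(2 * finrank ℝ E : ℝ)) ∂ν) ^
          (β / (2 * finrank ℝ E))) *
        ∫⁻ x, f x ^ (2 * finrank ℝ E / (2 * finrank ℝ E - β) : ℝ) ∂ν := by
  set D : ℝ := ((finrank ℝ E : ℕ) : ℝ) with hD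
  have hD0 : 0 < D := hβ.trans hβd
  have hDβ : 0 < 2 * D - β := by linarith
  set A := ∫⁻ x in Metric.ball 0 1, ‖x‖ₑ ^ (-β) ∂ν +
        (∫⁻ x in (Metric.ball 0 1)ᶜ, ‖x‖ₑ ^ (-(2 * D)) ∂ν) ^ (β / (2 * D)) with hA
  have hAt : A ≠ ⊤ := by
    refine ENNReal.add_ne_top.2 ⟨(setLIntegral_ball_one_enorm_rpow_lt_top ν hβ hβd).ne, ?_⟩
    refine ENNReal.rpow_ne_top_of_nonneg (by positivity) ?_
    exact (setLIntegral_compl_ball_one_enorm_rpow_lt_top ν (by linarith)).ne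
  rw [← lintegral_const_mul' _ _ hAt]
  refine lintegral_mono fun y => ?_
  by_cases hy : f y = 0
  · simp [hy]
  set G : E → ℝ≥0∞ := {u | g u ≤ f y}.indicator g with hG
  have hGm : Measurable G := hg.indicator (hg measurableSet_Iic)
  have hGle : ∀ x, G x ≤ g x := fun x => Set.indicator_le_self _ _ _
  have hGp : ∫⁻ x, G (y - x) ^ (2 * D / (2 * D - β)) ∂ν ≤ 1 := by
    rw [lintegral_sub_left_eq_self (fun x => G x ^ (2 * D / (2 * D - β))) y]
    exact (lintegral_mono fun x => ENNReal.rpow_le_rpow (hGle x) (by positivity)).trans hgp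
  have key := lintegral_mul_enorm_rpow_le_of_le ν hβ hβd (h := fun x => G (y - x)) (a := f y)
    (by fun_prop) hy (hft y) (fun x => by
      by_cases h : g (y - x) ≤ f y
      · simp [hG, h]
      · simp [hG, h]) hGp
  rw [← lintegral_sub_left_eq_self (fun x => G (y - x) * ‖x‖ₑ ^ (-β)) y] at key
  simp only [_root_.sub_sub_cancel] at key
  calc ∫⁻ u, {u | g u ≤ f y}.indicator (fun u => f y * g u * ‖y - u‖ₑ ^ (-β)) u ∂ν
      = f y * ∫⁻ u, G u * ‖y - u‖ₑ ^ (-β) ∂ν := by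
        rw [← lintegral_const_mul' _ _ (hft y)]
        refine lintegral_congr fun u => ?_
        by_cases h : g u ≤ f y <;> simp [hG, h, mul_assoc]
    _ ≤ f y * (A * f y ^ (β / (2 * D - β))) := mul_le_mul_right key _
    _ = A * f y ^ (2 * D / (2 * D - β)) := by
        have : 2 * D / (2 * D - β) = 1 + β / (2 * D - β) := by field_simp; ring
        rw [this, ENNReal.rpow_add _ _ hy (hft y), ENNReal.rpow_one]
        ring

/-- The diagonal case of the Hardy–Littlewood–Sobolev inequality, for functions of norm one. -/
theorem hardyLittlewoodSobolev_normalized {β : ℝ} (hβ : 0 < β) (hβd : β < finrank ℝ E)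
    {f g : E → ℝ≥0∞} (hf : Measurable f) (hg : Measurable g) (hft : ∀ x, f x ≠ ⊤)
    (hgt : ∀ x, g x ≠ ⊤)
    (hfp : ∫⁻ x, f x ^ (2 * finrank ℝ E / (2 * finrank ℝ E - β) : ℝ) ∂ν ≤ 1)
    (hgp : ∫⁻ x, g x ^ (2 * finrank ℝ E / (2 * finrank ℝ E - β) : ℝ) ∂ν ≤ 1) :
    ∫⁻ y, ∫⁻ u, f y * g u * ‖y - u‖ₑ ^ (-β) ∂ν ∂ν ≤
      2 * (∫⁻ x in Metric.ball 0 1, ‖x‖ₑ ^ (-β) ∂ν +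
        (∫⁻ x in (Metric.ball 0 1)ᶜ, ‖x‖ₑ ^ (-(2 * finrank ℝ E : ℝ)) ∂ν) ^
          (β / (2 * finrank ℝ E))) := by
  have h1 := lintegral_lintegral_le_one_side ν hβ hβd hg hft hgp
  have h2 := lintegral_lintegral_le_one_side ν hβ hβd hf hgt hfp
  have hmeas : ∀ {f g : E → ℝ≥0∞}, Measurable f → Measurable g → Measurable fun z : E × E =>
      {u | g u ≤ f z.1}.indicator (fun u => f z.1 * g u * ‖z.1 - u‖ₑ ^ (-β)) z.2 := by
    intro f g hf hg
    have hm : Measurable fun z : E × E => f z.1 * g z.2 * ‖z.1 - z.2‖ₑ ^ (-β) := by fun_prop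
    exact hm.indicator (s := {z : E × E | g z.2 ≤ f z.1})
      (measurableSet_le (by fun_prop) (by fun_prop))
  -- With the order of integration swapped, the two halves cover all pairs `(y, u)`, since the
  -- kernel is symmetric.
  rw [lintegral_lintegral_swap (hmeas hg hf).aemeasurable] at h2
  refine le_trans ?_ ((add_le_add (h1.trans (mul_le_mul_right hfp _))
    (h2.trans (mul_le_mul_right hgp _))).trans_eq (by ring))
  rw [← lintegral_add_left (Measurable.lintegral_prod_right (hmeas hf hg))]
  refine lintegral_mono fun y => ?_
  have hm : Measurable fun u => {u | g u ≤ f y}.indicator (fun u => f y * g u * ‖y - u‖ₑ ^ (-β)) u :=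
    (hmeas hf hg).comp (measurable_prodMk_left (x := y))
  rw [← lintegral_add_left hm]
  refine lintegral_mono fun u => ?_
  rcases le_total (g u) (f y) with h | h
  · refine le_trans ?_ le_self_add
    simp [h]
  · refine le_trans ?_ le_add_self
    simp [h, mul_comm (g u), norm_sub_rev, ← ofReal_norm]

end HardyLittlewoodSobolev

/-! ### Convolution bounds for the three classes of measures -/

section ConvolutionBound

variable {d : ℕ}

/-- The bilinear form `(f, g) ↦ ∫ f (g ∗ γ)` is bounded on nonnegative functions with finite
`L^p` norm. -/
def HasConvolutionBound (γ : Measure (EuclideanSpace ℝ (Fin d))) (p : ℝ) : Prop :=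
  ∃ C : ℝ≥0∞, C ≠ ⊤ ∧ ∀ f g : EuclideanSpace ℝ (Fin d) → ℝ≥0∞, Measurable f → Measurable g →
    (∀ x, f x ≠ ⊤) → (∀ x, g x ≠ ⊤) → ∫⁻ x, f x ^ p ≠ ⊤ → ∫⁻ x, g x ^ p ≠ ⊤ →
      ∫⁻ y, ∫⁻ x, f y * g (y - x) ∂γ ≤
        C * (∫⁻ x, f x ^ p) ^ (1 / p) * (∫⁻ x, g x ^ p) ^ (1 / p)

/-- `γ` may be singular, but `(y, x) ↦ y - x` still pulls Lebesgue null sets back to null sets of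
`volume.prod γ`. -/
theorem ae_ae_sub_of_ae {γ : Measure (EuclideanSpace ℝ (Fin d))} [SFinite γ]
    {P : EuclideanSpace ℝ (Fin d) → Prop} (h : ∀ᵐ x, P x) : ∀ᵐ y, ∀ᵐ x ∂γ, P (y - x) :=
  Measure.ae_ae_of_ae_prod
    ((quasiMeasurePreserving_sub_of_right_invariant volume γ).ae h)

theorem lintegral_normalize_rpow {p : ℝ} (hp : 0 < p)
    {f : EuclideanSpace ℝ (Fin d) → ℝ≥0∞} (h0 : ∫⁻ x, f x ^ p ≠ 0) (ht : ∫⁻ x, f x ^ p ≠ ⊤) :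
    ∫⁻ x, (((∫⁻ x, f x ^ p) ^ (1 / p))⁻¹ * f x) ^ p = 1 := by
  simp_rw [ENNReal.mul_rpow_of_nonneg _ _ hp.le]
  rw [lintegral_const_mul', ENNReal.inv_rpow, ← ENNReal.rpow_mul, one_div_mul_cancel hp.ne',
    ENNReal.rpow_one, ENNReal.inv_mul_cancel h0 ht]
  rw [ENNReal.inv_rpow, ← ENNReal.rpow_mul, one_div_mul_cancel hp.ne', ENNReal.rpow_one]
  exact ENNReal.inv_ne_top.2 h0

/-- By homogeneity; a function of zero norm cannot be normalized, but then the form vanishes. -/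
theorem HasConvolutionBound.of_normalized {γ : Measure (EuclideanSpace ℝ (Fin d))} [SFinite γ]
    {p : ℝ} (hp : 0 < p) {C : ℝ≥0∞} (hC : C ≠ ⊤)
    (h : ∀ f g : EuclideanSpace ℝ (Fin d) → ℝ≥0∞, Measurable f → Measurable g →
      (∀ x, f x ≠ ⊤) → (∀ x, g x ≠ ⊤) → ∫⁻ x, f x ^ p ≤ 1 → ∫⁻ x, g x ^ p ≤ 1 →
        ∫⁻ y, ∫⁻ x, f y * g (y - x) ∂γ ≤ C) : HasConvolutionBound γ p := by
  refine ⟨C, hC, fun f g hf hg hft hgt hfp hgp => ?_⟩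
  by_cases hf0 : ∫⁻ x, f x ^ p = 0
  · have hz := ae_eq_zero_of_lintegral_rpow_eq_zero hp.le hf.aemeasurable hf0
    refine le_trans (le_of_eq ?_) zero_le
    rw [← lintegral_zero (μ := (volume : Measure (EuclideanSpace ℝ (Fin d))))]
    refine lintegral_congr_ae ?_
    filter_upwards [hz] with y hy
    simp [hy]
  by_cases hg0 : ∫⁻ x, g x ^ p = 0
  · have hz := ae_eq_zero_of_lintegral_rpow_eq_zero hp.le hg.aemeasurable hg0
    refine le_trans (le_of_eq ?_) zero_le
    rw [← lintegral_zero (μ := (volume : Measure (EuclideanSpace ℝ (Fin d))))]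
    refine lintegral_congr_ae ?_
    filter_upwards [ae_ae_sub_of_ae (γ := γ) hz] with y hy
    rw [← lintegral_zero (μ := γ)]
    refine lintegral_congr_ae ?_
    filter_upwards [hy] with x hx
    simp [hx]
  have hnorm : ∀ {φ : EuclideanSpace ℝ (Fin d) → ℝ≥0∞}, ∫⁻ x, φ x ^ p ≠ 0 →
      ∫⁻ x, φ x ^ p ≠ ⊤ → (∫⁻ x, φ x ^ p) ^ (1 / p) ≠ 0 ∧ (∫⁻ x, φ x ^ p) ^ (1 / p) ≠ ⊤ :=
    fun h0 ht => ⟨(ENNReal.rpow_pos (pos_iff_ne_zero.2 h0) ht).ne',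
      ENNReal.rpow_ne_top_of_nonneg (by positivity) ht⟩
  obtain ⟨hF0, hFt⟩ := hnorm hf0 hfp
  obtain ⟨hG0, hGt⟩ := hnorm hg0 hgp
  have key := h _ _ (hf.const_mul ((∫⁻ x, f x ^ p) ^ (1 / p))⁻¹)
    (hg.const_mul ((∫⁻ x, g x ^ p) ^ (1 / p))⁻¹)
    (fun x => ENNReal.mul_ne_top (ENNReal.inv_ne_top.2 hF0) (hft x))
    (fun x => ENNReal.mul_ne_top (ENNReal.inv_ne_top.2 hG0) (hgt x))
    (lintegral_normalize_rpow hp hf0 hfp).le (lintegral_normalize_rpow hp hg0 hgp).le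
  set F := (∫⁻ x, f x ^ p) ^ (1 / p)
  set G := (∫⁻ x, g x ^ p) ^ (1 / p)
  have hFG : F⁻¹ * G⁻¹ ≠ ⊤ :=
    ENNReal.mul_ne_top (ENNReal.inv_ne_top.2 hF0) (ENNReal.inv_ne_top.2 hG0)
  have e : ∫⁻ y, ∫⁻ x, F⁻¹ * f y * (G⁻¹ * g (y - x)) ∂γ =
      F⁻¹ * G⁻¹ * ∫⁻ y, ∫⁻ x, f y * g (y - x) ∂γ := by
    simp_rw [← lintegral_const_mul' _ _ hFG]
    refine lintegral_congr fun y => lintegral_congr fun x => ?_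
    ring
  rw [e] at key
  calc ∫⁻ y, ∫⁻ x, f y * g (y - x) ∂γ
      = (F * F⁻¹) * (G * G⁻¹) * ∫⁻ y, ∫⁻ x, f y * g (y - x) ∂γ := by
        rw [ENNReal.mul_inv_cancel hF0 hFt, ENNReal.mul_inv_cancel hG0 hGt, one_mul, one_mul]
    _ = F * G * (F⁻¹ * G⁻¹ * ∫⁻ y, ∫⁻ x, f y * g (y - x) ∂γ) := by ring
    _ ≤ F * G * C := mul_le_mul_right key _
    _ = C * F * G := by ring

theorem measurable_rieszKernel (β : ℝ) (μ : Measure (EuclideanSpace ℝ (Fin d))) [SFinite μ] :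
    Measurable fun x => ∫⁻ z, ‖x - z‖ₑ ^ (-β) ∂μ :=
  Measurable.lintegral_prod_right'
    (f := fun w : EuclideanSpace ℝ (Fin d) × EuclideanSpace ℝ (Fin d) => ‖w.1 - w.2‖ₑ ^ (-β))
    (by fun_prop)

theorem hasConvolutionBound_rieszPotential {β : ℝ} (hβ : 0 < β) (hβd : β < d)
    (μ : Measure (EuclideanSpace ℝ (Fin d))) [IsFiniteMeasure μ] :
    HasConvolutionBound (rieszPotential β μ) (2 * d / (2 * d - β)) := by
  have hd0 : (0 : ℝ) < d := hβ.trans hβd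
  have hfr : ((finrank ℝ (EuclideanSpace ℝ (Fin d)) : ℕ) : ℝ) = d := by simp
  rw [rieszPotential, if_neg hβd.ne]
  set N : ℝ≥0∞ := 2 * (∫⁻ x in Metric.ball (0 : EuclideanSpace ℝ (Fin d)) 1, ‖x‖ₑ ^ (-β) ∂volume +
    (∫⁻ x in (Metric.ball (0 : EuclideanSpace ℝ (Fin d)) 1)ᶜ, ‖x‖ₑ ^ (-(2 * d : ℝ)) ∂volume) ^
      (β / (2 * d))) with hN
  have hNt : N ≠ ⊤ := by
    refine ENNReal.mul_ne_top (by simp) (ENNReal.add_ne_top.2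
      ⟨(setLIntegral_ball_one_enorm_rpow_lt_top volume hβ (by rwa [hfr])).ne, ?_⟩)
    refine ENNReal.rpow_ne_top_of_nonneg (by positivity) ?_
    exact (setLIntegral_compl_ball_one_enorm_rpow_lt_top volume (by rw [hfr]; linarith)).ne
  refine HasConvolutionBound.of_normalized (p := 2 * d / (2 * d - β))
    (div_pos (by linarith) (by linarith)) (C := N * μ Set.univ)
    (ENNReal.mul_ne_top hNt (measure_ne_top _ _)) fun f g hf hg hft hgt hfp hgp => ?_
  calc ∫⁻ y, ∫⁻ x, f y * g (y - x) ∂(volume.withDensity fun x => ∫⁻ z, ‖x - z‖ₑ ^ (-β) ∂μ)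
      = ∫⁻ y, ∫⁻ x, ∫⁻ z, f y * g (y - x) * ‖x - z‖ₑ ^ (-β) ∂μ := by
        refine lintegral_congr fun y => ?_
        rw [lintegral_withDensity_eq_lintegral_mul _ (measurable_rieszKernel β μ) (by fun_prop)]
        refine lintegral_congr fun x => ?_
        rw [lintegral_const_mul' _ _ (ENNReal.mul_ne_top (hft y) (hgt _)), Pi.mul_apply, mul_comm]
    _ = ∫⁻ y, ∫⁻ z, ∫⁻ x, f y * g (y - x) * ‖x - z‖ₑ ^ (-β) ∂volume ∂μ := by
        refine lintegral_congr fun y => ?_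
        rw [lintegral_lintegral_swap]
        exact (by fun_prop : Measurable fun w : EuclideanSpace ℝ (Fin d) ×
          EuclideanSpace ℝ (Fin d) => f y * g (y - w.1) * ‖w.1 - w.2‖ₑ ^ (-β)).aemeasurable
    _ = ∫⁻ z, ∫⁻ y, ∫⁻ x, f y * g (y - x) * ‖x - z‖ₑ ^ (-β) ∂volume ∂volume ∂μ := by
        rw [lintegral_lintegral_swap]
        refine (Measurable.lintegral_prod_right' (f := fun w : (EuclideanSpace ℝ (Fin d) ×
          EuclideanSpace ℝ (Fin d)) × EuclideanSpace ℝ (Fin d) =>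
            f w.1.1 * g (w.1.1 - w.2) * ‖w.2 - w.1.2‖ₑ ^ (-β)) ?_).aemeasurable
        fun_prop
    _ ≤ ∫⁻ z, N ∂μ := by
        refine lintegral_mono fun z => ?_
        -- Shifting `y` by `z` and putting `u = y + z - x` moves `z` from the kernel to a translate
        -- of `f`, whose norm is unchanged.
        have h := hardyLittlewoodSobolev_normalized
          (volume : Measure (EuclideanSpace ℝ (Fin d))) hβ (by rwa [hfr])
          (f := fun y => f (y + z)) (g := g) (by fun_prop) hg (fun x => hft _) hgt
          (by rw [hfr, lintegral_add_right_eq_self (fun x => f x ^ (2 * d / (2 * d - β) : ℝ))]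
              exact hfp) (by rwa [hfr])
        rw [hfr] at h
        refine le_trans (le_of_eq ?_) h
        rw [← lintegral_add_right_eq_self _ z]
        refine lintegral_congr fun y => ?_
        rw [← lintegral_sub_left_eq_self _ (y + z)]
        refine lintegral_congr fun u => ?_
        rw [_root_.sub_sub_cancel, add_sub_right_comm, add_sub_cancel_right]
    _ = N * μ Set.univ := lintegral_const _

theorem hasConvolutionBound_two (μ : Measure (EuclideanSpace ℝ (Fin d))) [IsFiniteMeasure μ] :
    HasConvolutionBound μ 2 := by
  refine ⟨μ Set.univ, measure_ne_top _ _, fun f g hf hg _ _ _ _ => ?_⟩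
  rw [lintegral_lintegral_swap (by
    exact (by fun_prop : Measurable fun w : EuclideanSpace ℝ (Fin d) ×
      EuclideanSpace ℝ (Fin d) => f w.1 * g (w.1 - w.2)).aemeasurable)]
  calc ∫⁻ x, ∫⁻ y, f y * g (y - x) ∂volume ∂μ
      ≤ ∫⁻ x, (∫⁻ y, f y ^ (2 : ℝ)) ^ (1 / 2 : ℝ) * (∫⁻ y, g y ^ (2 : ℝ)) ^ (1 / 2 : ℝ) ∂μ := by
        refine lintegral_mono fun x => ?_
        have h := ENNReal.lintegral_mul_le_Lp_mul_Lq volume Real.HolderConjugate.two_two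
          hf.aemeasurable (by fun_prop : Measurable fun y => g (y - x)).aemeasurable
        rwa [lintegral_sub_right_eq_self (fun y => g y ^ (2 : ℝ))] at h
    _ = _ := by rw [lintegral_const]; ring

/-- The weights sum to one, as three-function Hölder requires. The identity serves twice: for the
integrand, and to recombine the resulting integrals. -/
theorem young_factorization {s : ℝ} (hs : 1 < s) (F G K : ℝ≥0∞) :
    (F * G) ^ (1 - 1 / s) * (F * K) ^ (1 / (2 * s)) * (G * K) ^ (1 / (2 * s)) =
      K ^ (1 / s) * F ^ (1 - 1 / (2 * s)) * G ^ (1 - 1 / (2 * s)) := by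
  have h0 : 0 < s := by linarith
  have h1 : 0 ≤ 1 - 1 / s := by rw [sub_nonneg, div_le_one h0]; exact hs.le
  have h2 : 0 ≤ 1 / (2 * s) := by positivity
  have e1 : 1 - 1 / (2 * s) = (1 - 1 / s) + 1 / (2 * s) := by field_simp; ring
  have e2 : 1 / s = 1 / (2 * s) + 1 / (2 * s) := by field_simp; ring
  rw [ENNReal.mul_rpow_of_nonneg _ _ h1, ENNReal.mul_rpow_of_nonneg _ _ h2,
    ENNReal.mul_rpow_of_nonneg _ _ h2, e1, ENNReal.rpow_add_of_nonneg _ _ h1 h2,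
    ENNReal.rpow_add_of_nonneg _ _ h1 h2]
  have e3 : K ^ (1 / s) = K ^ (1 / (2 * s)) * K ^ (1 / (2 * s)) := by
    rw [← ENNReal.rpow_add_of_nonneg _ _ h2 h2, ← e2]
  rw [e3]
  ring

/-- Young's convolution inequality, in the bilinear form with two equal exponents. -/
theorem hasConvolutionBound_withDensity {s : ℝ} (hs : 1 < s)
    {k : EuclideanSpace ℝ (Fin d) → ℝ≥0∞} (hk : Measurable k) (hks : ∫⁻ x, k x ^ s ≠ ⊤) :
    HasConvolutionBound (volume.withDensity k) (2 * s / (2 * s - 1)) := by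
  have h0 : 0 < s := by linarith
  have h1 : 0 ≤ 1 - 1 / s := by rw [sub_nonneg, div_le_one h0]; exact hs.le
  have h21 : 2 * s - 1 ≠ 0 := by linarith
  set p := 2 * s / (2 * s - 1) with hp
  have hp1 : 1 / p = 1 - 1 / (2 * s) := by rw [hp]; field_simp
  have hp2 : p * (1 - 1 / (2 * s)) = 1 := by rw [hp]; field_simp
  refine ⟨(∫⁻ x, k x ^ s) ^ (1 / s), ENNReal.rpow_ne_top_of_nonneg (by positivity) hks,
    fun f g hf hg _ _ _ _ => ?_⟩
  have hpt : ∀ a b c : ℝ≥0∞, c * (a * b) = (a ^ p * b ^ p) ^ (1 - 1 / s) *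
      (a ^ p * c ^ s) ^ (1 / (2 * s)) * (b ^ p * c ^ s) ^ (1 / (2 * s)) := by
    intro a b c
    rw [young_factorization hs, ← ENNReal.rpow_mul, ← ENNReal.rpow_mul, ← ENNReal.rpow_mul, hp2,
      mul_one_div_cancel h0.ne', ENNReal.rpow_one, ENNReal.rpow_one, ENNReal.rpow_one, mul_assoc]
  -- Each factor involves only two of the three functions, so its double integral is a product of
  -- two single integrals.
  set A : Fin 3 → EuclideanSpace ℝ (Fin d) × EuclideanSpace ℝ (Fin d) → ℝ≥0∞ :=
    ![fun w => f w.1 ^ p * g (w.1 - w.2) ^ p, fun w => f w.1 ^ p * k w.2 ^ s,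
      fun w => g (w.1 - w.2) ^ p * k w.2 ^ s] with hA
  have hA0 : Measurable (A 0) := by simp only [hA, Matrix.cons_val_zero]; fun_prop
  have hA1 : Measurable (A 1) := by simp only [hA, Matrix.cons_val]; fun_prop
  have hA2 : Measurable (A 2) := by simp only [hA, Matrix.cons_val]; fun_prop
  have hAm : ∀ i, Measurable (A i) := by
    intro i; fin_cases i <;> assumption
  have I0 : ∫⁻ w, A 0 w = (∫⁻ x, f x ^ p) * ∫⁻ x, g x ^ p := by
    rw [Measure.volume_eq_prod, lintegral_prod _ hA0.aemeasurable,
      ← lintegral_mul_const _ (by fun_prop)]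
    refine lintegral_congr fun y => ?_
    simp only [hA, Matrix.cons_val_zero]
    rw [lintegral_const_mul _ (by fun_prop), lintegral_sub_left_eq_self (fun x => g x ^ p) y]
  have I1 : ∫⁻ w, A 1 w = (∫⁻ x, f x ^ p) * ∫⁻ x, k x ^ s := by
    rw [Measure.volume_eq_prod, lintegral_prod _ hA1.aemeasurable,
      ← lintegral_mul_const _ (by fun_prop)]
    refine lintegral_congr fun y => ?_
    simp only [hA, Matrix.cons_val]
    rw [lintegral_const_mul _ (by fun_prop)]
  have I2 : ∫⁻ w, A 2 w = (∫⁻ x, g x ^ p) * ∫⁻ x, k x ^ s := by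
    rw [Measure.volume_eq_prod, lintegral_prod_symm _ hA2.aemeasurable,
      ← lintegral_const_mul _ (by fun_prop)]
    refine lintegral_congr fun y => ?_
    simp only [hA, Matrix.cons_val]
    rw [lintegral_mul_const _ (by fun_prop), lintegral_sub_right_eq_self (fun x => g x ^ p) y]
  have key := ENNReal.lintegral_prod_norm_pow_le (μ := volume) Finset.univ (f := A)
    (fun i _ => (hAm i).aemeasurable) (p := ![1 - 1 / s, 1 / (2 * s), 1 / (2 * s)])
    (by simp only [Fin.sum_univ_three, Matrix.cons_val]; field_simp; ring)
    (fun i _ => by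
      fin_cases i
      · exact h1
      · change 0 ≤ 1 / (2 * s); positivity
      · change 0 ≤ 1 / (2 * s); positivity)
  simp only [Fin.prod_univ_three] at key
  rw [I0, I1, I2] at key
  simp only [Matrix.cons_val] at key
  rw [young_factorization hs] at key
  rw [hp1]
  refine le_trans (le_of_eq ?_) key
  rw [Measure.volume_eq_prod, lintegral_prod _ (by fun_prop)]
  refine lintegral_congr fun y => ?_
  rw [lintegral_withDensity_eq_lintegral_mul _ hk (by fun_prop)]
  exact lintegral_congr fun x => hpt _ _ _

/-! ### Admissible exponents and real-valued functions -/

theorem lt_exponentBound {α β : ℝ} (hα2 : α ≤ 2) (hβ : 0 < β) (hβα : β < α) (hβd : β ≤ d) :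
    1 < 2 * d / (2 * d - β) ∧ ENNReal.ofReal (2 * d / (2 * d - β)) < exponentBound d α := by
  have hd0 : (0 : ℝ) < d := hβ.trans_le hβd
  have hd1 : (1 : ℝ) ≤ d := by
    have : 0 < d := by exact_mod_cast hd0
    exact_mod_cast this
  have hα : 0 < α := hβ.trans hβα
  have hdβ : 0 < 2 * (d : ℝ) - β := by linarith
  refine ⟨by rw [lt_div_iff₀ hdβ]; linarith, lt_min ?_ ?_⟩
  · rcases eq_or_lt_of_le (show α ≤ 2 * d by linarith) with h | h
    -- When `α = 2d` the denominator is zero and the quotient in `[0, ∞]` is `⊤`.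
    · rw [← h, sub_self, ENNReal.ofReal_zero, ENNReal.div_zero (by simpa using hα)]
      exact ENNReal.ofReal_lt_top
    · rw [← ENNReal.ofReal_div_of_pos (by linarith), ENNReal.ofReal_lt_ofReal_iff
        (div_pos (by linarith) (by linarith))]
      exact div_lt_div_of_pos_left (by linarith) (by linarith) (by linarith)
  · rw [ENNReal.ofReal_lt_ofReal_iff (by positivity), div_lt_div_iff₀ hdβ hd0]
    -- `(d+α)(2d-β) - 2d² = d(α-β) + α(d-β)`.
    nlinarith [mul_pos hd0 (sub_pos.2 hβα), mul_nonneg hα.le (sub_nonneg.2 hβd)]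

theorem HasConvolutionBound.lintegral_prod_le {γ : Measure (EuclideanSpace ℝ (Fin d))} [SFinite γ]
    {p : ℝ} (hp : 0 < p) (h : HasConvolutionBound γ p) :
    ∃ C : ℝ≥0∞, C ≠ ⊤ ∧ ∀ f g : EuclideanSpace ℝ (Fin d) → ℝ,
      MemLp f (ENNReal.ofReal p) volume → MemLp g (ENNReal.ofReal p) volume →
        AEStronglyMeasurable (fun w : EuclideanSpace ℝ (Fin d) × EuclideanSpace ℝ (Fin d) =>
          f w.1 * g (w.1 - w.2)) (volume.prod γ) ∧
        ∫⁻ w, ‖f w.1 * g (w.1 - w.2)‖ₑ ∂(volume.prod γ) ≤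
          C * eLpNorm f (ENNReal.ofReal p) volume * eLpNorm g (ENNReal.ofReal p) volume := by
  obtain ⟨C, hC, h⟩ := h
  refine ⟨C, hC, fun f g hf hg => ?_⟩
  have hq := quasiMeasurePreserving_sub_of_right_invariant
    (volume : Measure (EuclideanSpace ℝ (Fin d))) γ
  refine ⟨(hf.aestronglyMeasurable.comp_quasiMeasurePreserving Measure.quasiMeasurePreserving_fst).mul
    (hg.aestronglyMeasurable.comp_quasiMeasurePreserving hq), ?_⟩
  have hp0 : ENNReal.ofReal p ≠ 0 := by simpa using hp
  have hnorm : ∀ φ : EuclideanSpace ℝ (Fin d) → ℝ, MemLp φ (ENNReal.ofReal p) volume →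
      ∃ ψ : EuclideanSpace ℝ (Fin d) → ℝ≥0∞, Measurable ψ ∧ (∀ x, ψ x ≠ ⊤) ∧
        (∀ᵐ x, ‖φ x‖ₑ = ψ x) ∧ ∫⁻ x, ψ x ^ p ≠ ⊤ ∧
        (∫⁻ x, ψ x ^ p) ^ (1 / p) = eLpNorm φ (ENNReal.ofReal p) volume := by
    intro φ hφ
    obtain ⟨χ, hχ, hae⟩ := hφ.aestronglyMeasurable
    have e : (∫⁻ x, ‖χ x‖ₑ ^ p) ^ (1 / p) = eLpNorm φ (ENNReal.ofReal p) volume := by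
      rw [eLpNorm_congr_ae hae, eLpNorm_eq_lintegral_rpow_enorm_toReal hp0 (by simp),
        ENNReal.toReal_ofReal hp.le]
    refine ⟨fun x => ‖χ x‖ₑ, hχ.measurable.enorm,
      fun x => by finiteness, ?_, fun ht => ?_, e⟩
    · filter_upwards [hae] with x hx
      rw [hx]
    · rw [ht, ENNReal.top_rpow_of_pos (by positivity)] at e
      exact hφ.2.ne e.symm
  obtain ⟨F, hFm, hFt, hFae, hFp, hFe⟩ := hnorm f hf
  obtain ⟨G, hGm, hGt, hGae, hGp, hGe⟩ := hnorm g hg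
  rw [← hFe, ← hGe]
  refine le_trans (le_of_eq ?_) (h F G hFm hGm hFt hGt hFp hGp)
  rw [← lintegral_prod (fun w : EuclideanSpace ℝ (Fin d) × EuclideanSpace ℝ (Fin d) =>
    F w.1 * G (w.1 - w.2)) (by fun_prop)]
  refine lintegral_congr_ae ?_
  filter_upwards [Measure.quasiMeasurePreserving_fst.ae hFae, hq.ae hGae] with w h1 h2
  rw [enorm_mul, h1, h2]

theorem HasConvolutionBound.integrable_and_integral_le
    {γ : Measure (EuclideanSpace ℝ (Fin d))} [SFinite γ]
    {p : ℝ} (hp : 0 < p) (h : HasConvolutionBound γ p) :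
    ∃ C : ℝ, ∀ f g : EuclideanSpace ℝ (Fin d) → ℝ,
      MemLp f (ENNReal.ofReal p) volume → MemLp g (ENNReal.ofReal p) volume →
        (∀ᵐ y ∂(volume : Measure (EuclideanSpace ℝ (Fin d))),
          Integrable (fun x => g (y - x)) γ) ∧
        Integrable (fun y => f y * convMeasure g γ y) volume ∧
        ∫ y, f y * convMeasure g γ y ≤
          C * (eLpNorm f (ENNReal.ofReal p) volume).toReal *
            (eLpNorm g (ENNReal.ofReal p) volume).toReal := by
  obtain ⟨C, hC, h⟩ := h.lintegral_prod_le hp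
  refine ⟨C.toReal, fun f g hf hg => ?_⟩
  have hfin : ∀ φ : EuclideanSpace ℝ (Fin d) → ℝ, MemLp φ (ENNReal.ofReal p) volume →
      C * eLpNorm φ (ENNReal.ofReal p) volume * eLpNorm g (ENNReal.ofReal p) volume ≠ ⊤ :=
    fun φ hφ => ENNReal.mul_ne_top (ENNReal.mul_ne_top hC hφ.2.ne) hg.2.ne
  have hint : ∀ φ : EuclideanSpace ℝ (Fin d) → ℝ, MemLp φ (ENNReal.ofReal p) volume →
      Integrable (fun w : EuclideanSpace ℝ (Fin d) × EuclideanSpace ℝ (Fin d) =>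
          φ w.1 * g (w.1 - w.2)) (volume.prod γ) := fun φ hφ =>
    ⟨(h φ g hφ hg).1, (h φ g hφ hg).2.trans_lt (hfin φ hφ).lt_top⟩
  have hconv : ∀ y, ∫ x, f y * g (y - x) ∂γ = f y * convMeasure g γ y := fun y =>
    integral_const_mul _ _
  refine ⟨?_, ?_, ?_⟩
  -- Taking `f` to be the indicator of a ball gives convergence for almost every `y` in it;
  -- countably many balls exhaust the space.
  · have hball : ∀ n : ℕ, ∀ᵐ y ∂(volume : Measure (EuclideanSpace ℝ (Fin d))),
        Integrable (fun x => (Metric.ball 0 (n : ℝ)).indicator (fun _ => (1 : ℝ)) y *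
          g (y - x)) γ := fun n =>
      (hint _ (memLp_indicator_const _ measurableSet_ball 1
        (Or.inr measure_ball_lt_top.ne))).prod_right_ae
    filter_upwards [ae_all_iff.2 hball] with y hy
    obtain ⟨n, hn⟩ := exists_nat_gt ‖y‖
    simpa [Set.indicator_of_mem (show y ∈ Metric.ball 0 (n : ℝ) by simpa using hn)] using hy n
  · simpa only [hconv] using (hint f hf).integral_prod_left
  · have e : ∫ y, f y * convMeasure g γ y = ∫ w, f w.1 * g (w.1 - w.2) ∂(volume.prod γ) := by
      rw [integral_prod _ (hint f hf)]
      simp only [hconv]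
    rw [e, ← ENNReal.toReal_mul, ← ENNReal.toReal_mul]
    refine (le_abs_self _).trans ?_
    rw [← Real.norm_eq_abs, ← toReal_enorm]
    exact ENNReal.toReal_mono (hfin f hf)
      ((enorm_integral_le_lintegral_enorm _).trans (h f g hf hg).2)

/-- A nonnegative integrable function in `L^r` lies in some `L^s` with `t < s < ∞`, for `t < r`. -/
theorem exists_lintegral_rpow_ne_top {k : EuclideanSpace ℝ (Fin d) → ℝ} {t : ℝ} (ht : 1 ≤ t)
    {r : ℝ≥0∞} (htr : ENNReal.ofReal t < r) (h1 : ∫⁻ x, ‖k x‖ₑ ≠ ⊤) (hr : MemLp k r volume) :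
    ∃ s, t < s ∧ ∫⁻ x, ‖k x‖ₑ ^ s ≠ ⊤ := by
  by_cases hrt : r = ⊤
  · subst hrt
    -- `|k|^{t+1} ≤ ‖k‖_∞^t |k|` almost everywhere.
    refine ⟨t + 1, by linarith, ?_⟩
    have hM : eLpNorm k ⊤ volume ≠ ⊤ := hr.2.ne
    have hle : ∀ᵐ x, ‖k x‖ₑ ≤ eLpNorm k ⊤ volume := by
      rw [eLpNorm_exponent_top]; exact ae_le_eLpNormEssSup
    have hMt : eLpNorm k ⊤ volume ^ t ≠ ⊤ := ENNReal.rpow_ne_top_of_nonneg (by linarith) hM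
    refine ne_top_of_le_ne_top (ENNReal.mul_ne_top hMt h1) ?_
    rw [← lintegral_const_mul' _ _ hMt]
    refine lintegral_mono_ae ?_
    filter_upwards [hle] with x hx
    rw [ENNReal.rpow_add_of_nonneg _ _ (by linarith) zero_le_one, ENNReal.rpow_one]
    gcongr
  · have hr0 : r ≠ 0 := (bot_lt_iff_ne_bot.1 (lt_of_le_of_lt bot_le htr))
    refine ⟨r.toReal, ?_, ?_⟩
    · exact (ENNReal.ofReal_lt_iff_lt_toReal (by linarith) hrt).1 htr
    · exact (lintegral_rpow_enorm_lt_top_of_eLpNorm_lt_top hr0 hrt hr.2).ne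

theorem CovarianceAssumption.exists_hasConvolutionBound {α : ℝ} (hα0 : 0 < α)
    {γ : Measure (EuclideanSpace ℝ (Fin d))} (hγ : CovarianceAssumption α γ) :
    SFinite γ ∧ ∃ β : ℝ, 0 < β ∧ β < α ∧ β ≤ d ∧
      HasConvolutionBound γ (2 * d / (2 * d - β)) := by
  obtain ⟨β, μ, hβ, hβd, hμ, -, rfl, hc⟩ := hγ
  have hd0 : (0 : ℝ) < d := hβ.trans_le hβd
  rcases hc with hc | ⟨rfl, rfl, hα⟩ | ⟨rfl, hαd, h, r, h0, hγ, hr, hm, -⟩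
  · have hβd' : β < d := hc.trans_le (min_le_right _ _)
    refine ⟨?_, β, hβ, hc.trans_le (min_le_left _ _), hβd,
      hasConvolutionBound_rieszPotential hβ hβd' μ⟩
    rw [rieszPotential, if_neg hβd'.ne]
    infer_instance
  · have e : rieszPotential (((1 : ℕ) : ℝ)) μ = μ := if_pos rfl
    rw [e]
    refine ⟨inferInstance, 1, one_pos, hα, by simp, ?_⟩
    convert hasConvolutionBound_two μ using 1
    norm_num
  · have e : rieszPotential (d : ℝ) μ = μ := if_pos rfl
    rw [e] at hγ ⊢
    have he : ∀ x, ENNReal.ofReal (h x) = ‖h x‖ₑ := fun x => (Real.enorm_of_nonneg (h0 x)).symm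
    have h1 : ∫⁻ x, ‖h x‖ₑ ≠ ⊤ := by
      have : μ Set.univ ≠ ⊤ := measure_ne_top _ _
      rwa [hγ, withDensity_apply _ MeasurableSet.univ, setLIntegral_univ,
        lintegral_congr he] at this
    have hdα : 1 ≤ d / α := by rwa [one_le_div hα0]
    obtain ⟨s, hs, hsi⟩ := exists_lintegral_rpow_ne_top hdα hr h1 hm
    have hs1 : 1 < s := hdα.trans_lt hs
    have hs0 : 0 < s := by linarith
    -- `s > d/α` means `d/s < α`, and `2d/(2d - d/s) = 2s/(2s-1)` is Young's exponent.
    refine ⟨inferInstance, d / s, by positivity, ?_, ?_, ?_⟩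
    · rw [div_lt_iff₀ hs0]
      rwa [div_lt_iff₀' hα0] at hs
    · exact div_le_self hd0.le hs1.le
    · obtain ⟨χ, hχ, hhχ⟩ := hm.aestronglyMeasurable
      have hae : (fun x => ENNReal.ofReal (h x)) =ᵐ[volume] fun x => ‖χ x‖ₑ := by
        filter_upwards [hhχ] with x hx
        rw [he, hx]
      have hsi' : ∫⁻ x, ‖χ x‖ₑ ^ s ≠ ⊤ := by
        rw [lintegral_congr_ae (g := fun x => ‖h x‖ₑ ^ s)]
        · exact hsi
        filter_upwards [hhχ] with x hx
        rw [hx]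
      have key := hasConvolutionBound_withDensity hs1
        hχ.measurable.enorm hsi'
      rw [← withDensity_congr_ae hae, ← hγ] at key
      convert key using 1
      have : 2 * s - 1 ≠ 0 := by linarith
      field_simp

end ConvolutionBound

end FractionalHeat

theorem proposition3p2 {d : ℕ} {α : ℝ} (hα0 : 0 < α) (hα2 : α ≤ 2)
    (γ : MeasureTheory.Measure (EuclideanSpace ℝ (Fin d)))
    (hγ : FractionalHeat.CovarianceAssumption α γ) :
    ∃ q : ℝ, 1 < 2 * q ∧ ENNReal.ofReal (2 * q) < FractionalHeat.exponentBound d α ∧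
      ∃ C : ℝ, ∀ f g : EuclideanSpace ℝ (Fin d) → ℝ,
        MemLp f (ENNReal.ofReal (2 * q)) volume → MemLp g (ENNReal.ofReal (2 * q)) volume →
          (∀ᵐ y ∂(volume : Measure (EuclideanSpace ℝ (Fin d))),
            Integrable (fun x => g (y - x)) γ) ∧
          Integrable (fun y => f y * FractionalHeat.convMeasure g γ y) volume ∧
          ∫ y, f y * FractionalHeat.convMeasure g γ y ≤
            C * (eLpNorm f (ENNReal.ofReal (2 * q)) volume).toReal *
              (eLpNorm g (ENNReal.ofReal (2 * q)) volume).toReal := by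
  obtain ⟨hs, β, hβ, hβα, hβd, hb⟩ := hγ.exists_hasConvolutionBound hα0
  obtain ⟨h1, h2⟩ := FractionalHeat.lt_exponentBound hα2 hβ hβα hβd
  have hq : 2 * (d / (2 * d - β)) = 2 * d / (2 * d - β) := by ring
  refine ⟨d / (2 * d - β), ?_, ?_, ?_⟩
  · rwa [hq]
  · rwa [hq]
  · rw [hq]
    exact hb.integrable_and_integral_le (by linarith)
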